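/- For $m\ge 1$ let $\mathbb{T}_m(\mathbb{R})$ be the set of lower triangular real $m\times m$ matrices whose diagonal entries are all equal. Let $\mathbb{S}$ be the set of real $2\times 2$ matrices of the form $\begin{bmatrix}\alpha&\beta\\-\beta&\alpha\end{bmatrix}$, and let $\mathbb{B}_m(\mathbb{R})$ be the set of real $2m\times 2m$ matrices which, cut into $2\times2$ blocks, are block lower triangular with all blocks in $\mathbb{S}$ and all diagonal blocks equal. Let $n\ge 1$ and $r,s\ge 0$ be integers and let $\eta=(n_1,\dots,n_r;m_1,\dots,m_s)$ be a sequence of positive integers (either part may be empty) with $(n_1+\dots+n_r)+2(m_1+\dots+m_s)=n$. Let $$\mathcal{K}_{\eta,r,s}(\mathbb{R})=\mathbb{T}_{n_1}(\mathbb{R})\oplus\dots\oplus\mathbb{T}_{n_r}(\mathbb{R})\oplus\mathbb{B}_{m_1}(\mathbb{R})\oplus\dots\oplus\mathbb{B}_{m_s}(\mathbb{R})$$ be the corresponding set of block diagonal matrices in $M_n(\mathbb{R})$. Let $G$ be an abelian sub-semigroup of $M_n(\mathbb{R})$ (under matrix multiplication) such that $P^{-1}GP\subset\mathcal{K}_{\eta,r,s}(\mathbb{R})$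 for some $P\in \mathrm{GL}(n,\mathbb{R})$, and suppose that $G$ is generated as a semigroup by $n-s$ (not necessarily distinct) matrices of $M_n(\mathbb{R})$. Then for every $v\in\mathbb{R}^n$ the orbit $G(v)=\{Av : A\in G\}$ is nowhere dense in $\mathbb{R}^n$, i.e. its closure has empty interior. -/

import Mathlib

open scoped Matrix

namespace AbelianSemigroup

/-- `𝕋_m(ℝ)`: lower triangular real `m × m` matrices with constant diagonal. -/
def realBlock (m : ℕ) : Set (Matrix (Fin m) (Fin m) ℝ) :=
  {M | ∃ μ : ℝ, (∀ i, M i i = μ) ∧ ∀ i j, i < j → M i j = 0}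

/-- `𝕊`: the real `2 × 2` matrices of the form `[α, β; -β, α]`. -/
def scalarBlock : Set (Matrix (Fin 2) (Fin 2) ℝ) :=
  {C | ∃ α β : ℝ, C = !![α, β; -β, α]}

/-- The `(i, j)` entry, itself a `2 × 2` matrix, of a `2m × 2m` matrix cut into `2 × 2` blocks. -/
def subBlock {m : ℕ} (M : Matrix (Fin m × Fin 2) (Fin m × Fin 2) ℝ) (i j : Fin m) :
    Matrix (Fin 2) (Fin 2) ℝ :=
  Matrix.of fun a b => M (i, a) (j, b)

/-- `𝔹_m(ℝ)`: the `2m × 2m` real matrices that are block lower triangular with `2 × 2` blocks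
in `𝕊` and with one and the same block `C` along the diagonal. -/
def complexBlock (m : ℕ) : Set (Matrix (Fin m × Fin 2) (Fin m × Fin 2) ℝ) :=
  {M | ∃ C ∈ scalarBlock, (∀ i, subBlock M i i = C) ∧
    (∀ i j, i < j → subBlock M i j = 0) ∧ ∀ i j, j < i → subBlock M i j ∈ scalarBlock}

/-- A sequence `η = (n₁, …, n_r; m₁, …, m_s)` of positive integers with
`(n₁ + ⋯ + n_r) + 2 (m₁ + ⋯ + m_s) = n`; either part may be empty. -/
structure BlockSizes (n r s : ℕ) where
  realSize : Fin r → ℕ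
  complexSize : Fin s → ℕ
  realSize_pos : ∀ k, 0 < realSize k
  complexSize_pos : ∀ l, 0 < complexSize l
  sum_eq : ∑ k, realSize k + 2 * ∑ l, complexSize l = n

theorem BlockSizes.index_card {n r s : ℕ} (η : BlockSizes n r s) :
    ∑ k, η.realSize k + ∑ l, η.complexSize l * 2 = n := by
  rw [← Finset.sum_mul, mul_comm, η.sum_eq]

/-- The consecutive numbering, by `0, …, n - 1`, of the positions in the successive diagonal
blocks: first the blocks of sizes `n₁, …, n_r`, then those of sizes `2m₁, …, 2m_s`. -/
def BlockSizes.position {n r s : ℕ} (η : BlockSizes n r s) :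
    ((Σ k : Fin r, Fin (η.realSize k)) ⊕ (Σ l : Fin s, Fin (η.complexSize l) × Fin 2)) ≃ Fin n :=
  (Equiv.sumCongr finSigmaFinEquiv
    ((Equiv.sigmaCongrRight fun _ => finProdFinEquiv).trans finSigmaFinEquiv)).trans
    (finSumFinEquiv.trans (finCongr η.index_card))

/-- `𝒦_{η,r,s}(ℝ) = 𝕋_{n₁}(ℝ) ⊕ ⋯ ⊕ 𝕋_{n_r}(ℝ) ⊕ 𝔹_{m₁}(ℝ) ⊕ ⋯ ⊕ 𝔹_{m_s}(ℝ)`: the block diagonal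
`n × n` matrices with these successive diagonal blocks. -/
def normalForms {n r s : ℕ} (η : BlockSizes n r s) : Set (Matrix (Fin n) (Fin n) ℝ) :=
  {M | ∃ (T : ∀ k, Matrix (Fin (η.realSize k)) (Fin (η.realSize k)) ℝ)
      (B : ∀ l, Matrix (Fin (η.complexSize l) × Fin 2) (Fin (η.complexSize l) × Fin 2) ℝ),
    (∀ k, T k ∈ realBlock (η.realSize k)) ∧ (∀ l, B l ∈ complexBlock (η.complexSize l)) ∧
    M = Matrix.reindex η.position η.position
      (Matrix.fromBlocks (Matrix.blockDiagonal' T) 0 0 (Matrix.blockDiagonal' B))}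

/-- `G` has normal form in `𝒦_{η,r,s}(ℝ)`: for some `P ∈ GL(n, ℝ)` one has
`P⁻¹ G P ⊆ 𝒦_{η,r,s}(ℝ)`. -/
def HasNormalFormIn {n r s : ℕ} (G : Subsemigroup (Matrix (Fin n) (Fin n) ℝ))
    (η : BlockSizes n r s) : Prop :=
  ∃ P : GL (Fin n) ℝ, ∀ A ∈ G,
    ((P⁻¹ : GL (Fin n) ℝ) : Matrix (Fin n) (Fin n) ℝ) * A * (P : Matrix (Fin n) (Fin n) ℝ)
      ∈ normalForms η

/-- The orbit `G(v) = {A v : A ∈ G}`. -/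
def orbit {n : ℕ} (G : Subsemigroup (Matrix (Fin n) (Fin n) ℝ)) (v : Fin n → ℝ) :
    Set (Fin n → ℝ) :=
  {w | ∃ A ∈ G, A *ᵥ v = w}

end AbelianSemigroup

/-! The generators and the scalar block tuples span a commutative algebra `R` acting faithfully on V
= ℝⁿ, with a split surjection onto ℝ^r × ℂ^s whose kernel is nil. If x ↦ x • v is not onto, the
orbit lies in a proper subspace. If it is onto, commutativity and faithfulness make it a linear
isomorphism `R` ≃ V, so the problem moves into `R`, of dimension n
(`isNowhereDense_range_prod_smul`).

In `R`, products involving a non-unit lie in finitely many proper ideals. For units, the squares of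
the generators have logarithms, so up to the finitely many parity patterns of exponents the products
lie in exp H, where H is the additive group generated by the n - s logarithms and the s periods 2πi
of the complex factors. With n generators in dimension n, H is a lattice or spans a proper subspace,
hence is nowhere dense. As exp is open and H contains its kernel, exp H is nowhere dense too
(`isNowhereDense_image_exp`). -/

namespace AbelianSemigroup

open NormedSpace

/-! ### Nowhere dense sets, subspaces and finitely generated subgroups -/

section NowhereDense

theorem isNowhereDense_union {X : Type*} [TopologicalSpace X] {s t : Set X}
    (hs : IsNowhereDense s) (ht : IsNowhereDense t) : IsNowhereDense (s ∪ t) := by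
  unfold IsNowhereDense at *
  rw [closure_union, interior_union_isClosed_of_interior_empty isClosed_closure ht, hs]

theorem isNowhereDense_iUnion {X ι : Type*} [TopologicalSpace X] [Finite ι] {s : ι → Set X}
    (hs : ∀ i, IsNowhereDense (s i)) : IsNowhereDense (⋃ i, s i) := by
  have key : ∀ t : Set ι, t.Finite → IsNowhereDense (⋃ i ∈ t, s i) := by
    intro t ht
    induction t, ht using Set.Finite.induction_on with
    | empty => simp
    | insert _ _ ih =>
      rw [Set.biUnion_insert]
      exact isNowhereDense_union (hs _) ih
  simpa using key Set.univ Set.finite_univ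

theorem isNowhereDense_homeomorph_image {X Y : Type*} [TopologicalSpace X] [TopologicalSpace Y]
    (e : X ≃ₜ Y) {s : Set X} (hs : IsNowhereDense s) : IsNowhereDense (e '' s) := by
  unfold IsNowhereDense at *
  rw [← e.image_closure, ← e.image_interior, hs, Set.image_empty]

variable {V : Type*} [NormedAddCommGroup V] [NormedSpace ℝ V] [FiniteDimensional ℝ V]

theorem isNowhereDense_submodule {W : Submodule ℝ V} (hW : W ≠ ⊤) :
    IsNowhereDense (W : Set V) := by
  rw [W.closed_of_finiteDimensional.isNowhereDense_iff]
  by_contra h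
  exact hW (W.eq_top_of_nonempty_interior' (Set.nonempty_iff_ne_empty.mpr h))

theorem isNowhereDense_range_of_not_surjective {U : Type*} [AddCommGroup U] [Module ℝ U]
    {f : U →ₗ[ℝ] V} (hf : ¬ Function.Surjective f) : IsNowhereDense (Set.range f) := by
  rw [← LinearMap.coe_range]
  exact isNowhereDense_submodule fun h => hf (LinearMap.range_eq_top.mp h)

/-- A subgroup of a real vector space of dimension `d ≥ 1` with at most `d` generators is
nowhere dense. -/
theorem isNowhereDense_addSubgroup_closure [Nontrivial V] {J : Type*} [Fintype J] (c : J → V)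
    (hJ : Fintype.card J ≤ Module.finrank ℝ V) :
    IsNowhereDense (AddSubgroup.closure (Set.range c) : Set V) := by
  -- Spanning forces the generators to be a basis, so the subgroup is a lattice: discrete, hence
  -- closed, and countable.
  by_cases hspan : Submodule.span ℝ (Set.range c) = ⊤
  · have hcard : Fintype.card J = Module.finrank ℝ V :=
      le_antisymm hJ (finrank_le_of_span_eq_top hspan)
    have hli : LinearIndependent ℝ c := linearIndependent_of_top_le_span_of_card_eq_finrank
      hspan.ge hcard
    let b := Module.Basis.mk hli hspan.ge
    have hb : (b : J → V) = c := Module.Basis.coe_mk _ _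
    have hL : (Submodule.span ℤ (Set.range b)).toAddSubgroup
        = AddSubgroup.closure (Set.range c) := by
      rw [hb]; exact Submodule.span_int_eq_addSubgroupClosure _
    rw [← hL]
    have hclosed : IsClosed ((Submodule.span ℤ (Set.range b)).toAddSubgroup : Set V) :=
      AddSubgroup.isClosed_of_discrete
    rw [hclosed.isNowhereDense_iff, interior_eq_empty_iff_dense_compl]
    refine Set.Countable.dense_compl ℝ ?_
    have : Countable (Submodule.span ℤ (Set.range b)) := inferInstance
    exact Set.countable_coe_iff.mp this
  · refine (isNowhereDense_submodule hspan).mono ?_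
    have : AddSubgroup.closure (Set.range c) ≤ (Submodule.span ℝ (Set.range c)).toAddSubgroup :=
      (AddSubgroup.closure_le _).mpr Submodule.subset_span
    exact this

end NowhereDense

/-! ### The exponential of a commutative Banach algebra -/

section Exponential

variable {R : Type*} [NormedCommRing R] [NormedAlgebra ℝ R]

/-- The derivative at x is multiplication by the unit exp x, hence onto. -/
theorem exp_isOpenMap [CompleteSpace R] : IsOpenMap (exp : R → R) := by
  let _ : NormedAlgebra ℚ R := NormedAlgebra.restrictScalars ℚ ℝ R
  rw [isOpenMap_iff_nhds_le]
  intro x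
  have h : HasStrictFDerivAt exp (exp x • (1 : R →L[ℝ] R)) x := hasStrictFDerivAt_exp
  refine (h.map_nhds_eq_of_surj ?_).ge
  rw [LinearMap.range_eq_top]
  intro y
  obtain ⟨u, hu⟩ := isUnit_exp x
  exact ⟨(↑u⁻¹ : R) * y, by simp [← hu]⟩

/-- Containing the kernel makes H the full preimage of exp H; openness of exp then pulls an open set
in the closure of exp H back into the closure of H. -/
theorem isNowhereDense_image_exp [CompleteSpace R] {H : AddSubgroup R}
    (hker : ∀ x : R, exp x = 1 → x ∈ H) (hH : IsNowhereDense (H : Set R)) :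
    IsNowhereDense (exp '' (H : Set R)) := by
  let _ : NormedAlgebra ℚ R := NormedAlgebra.restrictScalars ℚ ℝ R
  have hpre : exp ⁻¹' (exp '' (H : Set R)) = H := by
    refine Set.Subset.antisymm ?_ (Set.subset_preimage_image _ _)
    rintro x ⟨y, hy, hxy⟩
    have h1 : exp (x - y) = 1 := by
      rw [sub_eq_add_neg, exp_add, ← hxy, ← exp_add, add_neg_cancel, exp_zero]
    simpa using H.add_mem (hker _ h1) hy
  unfold IsNowhereDense at *
  rw [← Set.not_nonempty_iff_eq_empty] at hH ⊢
  intro hne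
  apply hH
  obtain ⟨w, hw, x, hx, rfl⟩ : (interior (closure (exp '' (H : Set R))) ∩
      exp '' (H : Set R)).Nonempty :=
    mem_closure_iff.mp (interior_subset hne.some_mem) _ isOpen_interior hne.some_mem
  refine ⟨x, mem_interior.mpr ⟨exp ⁻¹' interior (closure (exp '' (H : Set R))), ?_,
    isOpen_interior.preimage exp_continuous, hw⟩⟩
  refine (Set.preimage_mono interior_subset).trans ?_
  refine exp_isOpenMap.preimage_closure_subset_closure_preimage.trans ?_
  rw [hpre]

/-- From exp N = 1 + N + N²w one gets N = N(-Nw); iterating, the nilpotent factor kills N. -/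
theorem eq_zero_of_exp_eq_one {N : R} (hN : IsNilpotent N) (h : exp N = 1) : N = 0 := by
  obtain ⟨m, hm⟩ := hN
  have hpow : ∀ k, m ≤ k → N ^ k = 0 := fun k hk => pow_eq_zero_of_le hk hm
  have hsum : exp N = ∑ k ∈ Finset.range (m + 2), ((k.factorial : ℝ)⁻¹) • N ^ k := by
    rw [exp_eq_tsum ℝ]
    refine tsum_eq_sum fun k hk => ?_
    rw [hpow k (by simp at hk; omega), smul_zero]
  rw [Finset.sum_range_succ', Finset.sum_range_succ'] at hsum
  set w := ∑ k ∈ Finset.range m, (((k + 1 + 1).factorial : ℝ)⁻¹) • N ^ k with hw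
  have hsum' : exp N = N * (N * w) + N + 1 := by
    rw [hsum, hw]
    simp only [Finset.mul_sum]
    congr 1
    · congr 1
      · refine Finset.sum_congr rfl fun k _ => ?_
        simp only [mul_smul_comm, pow_succ']
      · simp
    · simp
  have hrec : N = N * (-(N * w)) := by
    rw [h] at hsum'
    linear_combination -hsum'
  have hall : ∀ j : ℕ, N = N * (-(N * w)) ^ j := by
    intro j
    induction j with
    | zero => simp
    | succ j ih =>
      rw [pow_succ, ← mul_assoc, ← ih]
      exact hrec
  rw [hall m, neg_pow, mul_pow, hm]
  simp

/-- An element of a commutative Banach algebra that is joined to `exp d` by a line of invertible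
elements is an exponential. -/
theorem exists_exp_eq_add_of_isUnit [CompleteSpace R] (d x : R)
    (h : ∀ t : ℝ, IsUnit (exp d + t • x)) : ∃ b, exp b = exp d + x := by
  let _ : NormedAlgebra ℚ R := NormedAlgebra.restrictScalars ℚ ℝ R
  have hcont : Continuous fun t : ℝ => exp d + t • x := by fun_prop
  have hopen : IsOpen (Set.range (exp : R → R)) := exp_isOpenMap.isOpen_range
  -- Connectedness of ℝ. For closedness, dividing by the unit at t gives exponentials for s near t,
  -- so s belongs to the set only if t does.
  have hclopen : IsClopen ((fun t : ℝ => exp d + t • x) ⁻¹' Set.range exp) := by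
    refine ⟨⟨?_⟩, hopen.preimage hcont⟩
    rw [isOpen_iff_mem_nhds]
    intro t ht
    obtain ⟨u, hu⟩ := h t
    have hmul : Continuous fun s : ℝ => (↑u⁻¹ : R) * (exp d + s • x) := by fun_prop
    have hmem : (fun s : ℝ => (↑u⁻¹ : R) * (exp d + s • x)) ⁻¹' Set.range exp ∈ nhds t := by
      refine (hopen.preimage hmul).mem_nhds ⟨0, ?_⟩
      simp [← hu]
    filter_upwards [hmem] with s hs hs'
    obtain ⟨a, ha⟩ := hs
    obtain ⟨c, hc⟩ := hs'
    refine ht ⟨c - a, ?_⟩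
    simp only at ha hc
    have h1 : exp c = u * exp a := by rw [hc, ha, Units.mul_inv_cancel_left]
    simp only
    rw [← hu, sub_eq_add_neg, exp_add, h1, mul_assoc, ← exp_add, add_neg_cancel, exp_zero, mul_one]
  have huniv := hclopen.eq_univ ⟨0, d, by simp⟩
  have : (1 : ℝ) ∈ (fun t : ℝ => exp d + t • x) ⁻¹' Set.range exp := huniv ▸ Set.mem_univ _
  simpa using this

end Exponential

end AbelianSemigroup

namespace AbelianSemigroup

open NormedSpace

/-! ### Finitely generated semigroups in a split commutative algebra -/

section SplitAlgebra

variable {ι κ : Type*} [Fintype ι] [Fintype κ]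

theorem semisimple_exp_eq_one [DecidableEq κ] {z : (ι → ℝ) × (κ → ℂ)} (hz : exp z = 1) :
    ∃ m : κ → ℤ, z = ∑ l, m l • ((0, Pi.single l (2 * Real.pi * Complex.I)) :
      (ι → ℝ) × (κ → ℂ)) := by
  have h1 : ∀ k, z.1 k = 0 := by
    intro k
    have := congrFun (congrArg Prod.fst hz) k
    rw [Prod.fst_exp, Pi.coe_exp, ← Real.exp_eq_exp_ℝ] at this
    simpa using this
  have h2 : ∀ l, ∃ m : ℤ, z.2 l = m * (2 * Real.pi * Complex.I) := by
    intro l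
    have := congrFun (congrArg Prod.snd hz) l
    rw [Prod.snd_exp, Pi.coe_exp, ← Complex.exp_eq_exp_ℂ] at this
    exact Complex.exp_eq_one_iff.mp this
  choose m hm using h2
  refine ⟨m, Prod.ext (funext fun k => ?_) (funext fun l => ?_)⟩
  · simp [h1, Prod.fst_sum]
  · simp [hm, Prod.snd_sum, Finset.sum_apply, Pi.single_apply]

theorem semisimple_exists_exp_eq {z : (ι → ℝ) × (κ → ℂ)} (h1 : ∀ k, 0 < z.1 k)
    (h2 : ∀ l, z.2 l ≠ 0) : ∃ y, exp y = z := by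
  refine ⟨(fun k => Real.log (z.1 k), fun l => Complex.log (z.2 l)),
    Prod.ext (funext fun k => ?_) (funext fun l => ?_)⟩
  · rw [Prod.fst_exp, Pi.coe_exp, ← Real.exp_eq_exp_ℝ]
    exact Real.exp_log (h1 k)
  · rw [Prod.snd_exp, Pi.coe_exp, ← Complex.exp_eq_exp_ℂ]
    exact Complex.exp_log (h2 l)

variable {R : Type*} [NormedCommRing R] [NormedAlgebra ℝ R]
  (π : R →ₐ[ℝ] (ι → ℝ) × (κ → ℂ)) (σ : ((ι → ℝ) × (κ → ℂ)) →ₐ[ℝ] R)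

theorem algHom_exp (z : (ι → ℝ) × (κ → ℂ)) : exp (σ z) = σ (exp z) := by
  let _ : NormedAlgebra ℚ R := NormedAlgebra.restrictScalars ℚ ℝ R
  exact (map_exp σ (LinearMap.continuous_of_finiteDimensional σ.toLinearMap) z).symm

variable [FiniteDimensional ℝ R]

/-- The semisimple part σ (π x) also has exponential 1, hence so does the nilpotent part, which must
vanish; the periods of ℂ^κ remain. -/
theorem exp_eq_one_mem_closure [DecidableEq κ] (hπσ : ∀ z, π (σ z) = z)
    (hnil : ∀ x, π x = 0 → IsNilpotent x) {x : R} (hx : exp x = 1) :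
    x ∈ AddSubgroup.closure
      (Set.range fun l => σ (0, Pi.single l (2 * Real.pi * Complex.I))) := by
  let _ : NormedAlgebra ℚ R := NormedAlgebra.restrictScalars ℚ ℝ R
  have : CompleteSpace R := FiniteDimensional.complete ℝ R
  have hπx : exp (π x) = 1 := by
    rw [← map_exp π (LinearMap.continuous_of_finiteDimensional π.toLinearMap) x, hx, map_one]
  have hy : exp (σ (π x)) = 1 := by rw [algHom_exp, hπx, map_one]
  have hsub : exp (x - σ (π x)) = 1 := by
    have : exp (x - σ (π x)) * exp (σ (π x)) = 1 := by rw [← exp_add, sub_add_cancel, hx]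
    rwa [hy, mul_one] at this
  have hxy : x = σ (π x) :=
    sub_eq_zero.mp (eq_zero_of_exp_eq_one (hnil _ (by rw [map_sub, hπσ, sub_self])) hsub)
  obtain ⟨m, hm⟩ := semisimple_exp_eq_one hπx
  rw [hxy, hm, map_sum]
  refine AddSubgroup.sum_mem _ fun l _ => ?_
  rw [map_zsmul]
  exact AddSubgroup.zsmul_mem _ (AddSubgroup.subset_closure (Set.mem_range_self l)) _

/-- The semisimple part has a logarithm coordinatewise, and adding multiples of the nilpotent part
keeps it invertible. -/
theorem exists_exp_eq_of_pos (hπσ : ∀ z, π (σ z) = z)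
    (hnil : ∀ x, π x = 0 → IsNilpotent x) {a : R} (ha : IsUnit a) (hpos : ∀ k, 0 < (π a).1 k) :
    ∃ b, exp b = a := by
  let _ : NormedAlgebra ℚ R := NormedAlgebra.restrictScalars ℚ ℝ R
  have : CompleteSpace R := FiniteDimensional.complete ℝ R
  have hne : ∀ l, (π a).2 l ≠ 0 := by
    intro l
    have h1 : IsUnit (π a) := ha.map π
    have h2 := (h1.map (RingHom.snd (ι → ℝ) (κ → ℂ))).map (Pi.evalRingHom (fun _ : κ => ℂ) l)
    exact h2.ne_zero
  obtain ⟨y, hy⟩ := semisimple_exists_exp_eq hpos hne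
  have hD : exp (σ y) = σ (π a) := by rw [algHom_exp, hy]
  have hN : IsNilpotent (a - σ (π a)) := hnil _ (by rw [map_sub, hπσ, sub_self])
  obtain ⟨b, hb⟩ := exists_exp_eq_add_of_isUnit (σ y) (a - σ (π a)) fun t =>
    (hN.smul t).isUnit_add_left_of_commute (isUnit_exp _) (Commute.all _ _)
  exact ⟨b, by rw [hb, hD, add_sub_cancel]⟩

/-- The products of `p` elements that have logarithms lie in the exponential of a subgroup with
`p + |κ|` generators. -/
theorem isNowhereDense_range_prod_exp [Nontrivial R] {J : Type*} [Fintype J]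
    (hπσ : ∀ z, π (σ z) = z) (hnil : ∀ x, π x = 0 → IsNilpotent x) (b : J → R)
    (hJ : Fintype.card J + Fintype.card κ ≤ Module.finrank ℝ R) :
    IsNowhereDense (Set.range fun m : J → ℕ => ∏ i, exp (b i) ^ m i) := by
  classical
  let _ : NormedAlgebra ℚ R := NormedAlgebra.restrictScalars ℚ ℝ R
  have : CompleteSpace R := FiniteDimensional.complete ℝ R
  let e : κ → R := fun l => σ (0, Pi.single l (2 * Real.pi * Complex.I))
  have hH := isNowhereDense_addSubgroup_closure (Sum.elim b e) (by simpa using hJ)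
  have hker : ∀ x : R, exp x = 1 → x ∈ AddSubgroup.closure (Set.range (Sum.elim b e)) :=
    fun x hx => AddSubgroup.closure_mono
      (Set.Sum.elim_range b e ▸ Set.subset_union_right)
      (exp_eq_one_mem_closure π σ hπσ hnil hx)
  refine (isNowhereDense_image_exp hker hH).mono ?_
  rintro _ ⟨m, rfl⟩
  refine ⟨∑ i, m i • b i, AddSubgroup.sum_mem _ fun i _ =>
    AddSubgroup.nsmul_mem _ (AddSubgroup.subset_closure (Set.mem_range_self (f := Sum.elim b e) (Sum.inl i))) _, ?_⟩
  rw [exp_sum]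
  simp only [exp_nsmul]

theorem isNowhereDense_range_prod_of_isUnit [Nontrivial R] {J : Type*} [Fintype J]
    (hπσ : ∀ z, π (σ z) = z) (hnil : ∀ x, π x = 0 → IsNilpotent x) (a : J → R)
    (ha : ∀ i, IsUnit (a i))
    (hJ : Fintype.card J + Fintype.card κ ≤ Module.finrank ℝ R) :
    IsNowhereDense (Set.range fun m : J → ℕ => ∏ i, a i ^ m i) := by
  classical
  -- Squaring makes all real characters positive; the lost parities cost one translate by a unit for
  -- each ε.
  have hlog : ∀ i, ∃ b, exp b = a i ^ 2 := by
    intro i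
    refine exists_exp_eq_of_pos π σ hπσ hnil ((ha i).pow 2) fun k => ?_
    have h1 : IsUnit (π (a i)) := (ha i).map π
    have h2 := (h1.map (RingHom.fst (ι → ℝ) (κ → ℂ))).map (Pi.evalRingHom (fun _ : ι => ℝ) k)
    have h3 : (π (a i)).1 k ≠ 0 := h2.ne_zero
    rw [map_pow]
    exact sq_pos_of_ne_zero h3
  choose b hb using hlog
  have hsq := isNowhereDense_range_prod_exp π σ hπσ hnil b hJ
  have hunit : ∀ ε : J → Fin 2, IsUnit (∏ i, a i ^ (ε i : ℕ)) := fun ε =>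
    IsUnit.prod_univ_iff.mpr fun i => (ha i).pow _
  refine (isNowhereDense_iUnion fun ε : J → Fin 2 =>
    isNowhereDense_homeomorph_image (Homeomorph.smul (hunit ε).unit) hsq).mono ?_
  rintro _ ⟨m, rfl⟩
  refine Set.mem_iUnion.mpr ⟨fun i => ⟨m i % 2, Nat.mod_lt _ two_pos⟩, _,
    ⟨fun i => m i / 2, rfl⟩, ?_⟩
  simp [Units.smul_def, hb, ← Finset.prod_mul_distrib, ← pow_mul, ← pow_add, Nat.mod_add_div]

theorem isNowhereDense_range_prod [Nontrivial R] {J : Type*} [Fintype J]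
    (hπσ : ∀ z, π (σ z) = z) (hnil : ∀ x, π x = 0 → IsNilpotent x) (a : J → R)
    (hJ : Fintype.card J + Fintype.card κ ≤ Module.finrank ℝ R) :
    IsNowhereDense (Set.range fun m : J → ℕ => ∏ i, a i ^ m i) := by
  classical
  -- Non-units are replaced by 1, which covers the products where they have exponent 0.
  have hunits := isNowhereDense_range_prod_of_isUnit π σ hπσ hnil
    (fun i => if IsUnit (a i) then a i else 1) (fun i => by split_ifs with h <;> simp [h]) hJ
  have hnon : ∀ i : {i // ¬ IsUnit (a i)},
      IsNowhereDense (Set.range (LinearMap.mulLeft ℝ (a i))) := by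
    intro i
    refine isNowhereDense_range_of_not_surjective fun hsurj => i.2 ?_
    obtain ⟨c, hc⟩ := hsurj 1
    exact IsUnit.of_mul_eq_one c (by simpa using hc)
  refine (isNowhereDense_union hunits (isNowhereDense_iUnion hnon)).mono ?_
  rintro _ ⟨m, rfl⟩
  by_cases hm : ∃ i, ¬ IsUnit (a i) ∧ m i ≠ 0
  · obtain ⟨i, hi, hmi⟩ := hm
    obtain ⟨c, hc⟩ := (dvd_pow_self (a i) hmi).trans
      (Finset.dvd_prod_of_mem (fun i => a i ^ m i) (Finset.mem_univ i))
    exact Or.inr (Set.mem_iUnion.mpr ⟨⟨i, hi⟩, c, by simpa using hc.symm⟩)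
  · push Not at hm
    refine Or.inl ⟨m, Finset.prod_congr rfl fun i _ => ?_⟩
    by_cases hi : IsUnit (a i)
    · simp [hi]
    · simp [hm i hi]

end SplitAlgebra

end AbelianSemigroup

namespace AbelianSemigroup

/-! ### From orbits in a module to the algebra -/

section SplitModule

variable {ι κ : Type*} [Fintype ι] [Fintype κ] {V : Type*} [NormedAddCommGroup V]
  [NormedSpace ℝ V] [FiniteDimensional ℝ V] [Nontrivial V]

theorem isNowhereDense_range_prod_smul {R : Type*} [CommRing R] [Algebra ℝ R] [Module R V]
    [IsScalarTower ℝ R V] [FaithfulSMul R V]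
    (π : R →ₐ[ℝ] (ι → ℝ) × (κ → ℂ)) (σ : ((ι → ℝ) × (κ → ℂ)) →ₐ[ℝ] R)
    (hπσ : ∀ z, π (σ z) = z) (hnil : ∀ x, π x = 0 → IsNilpotent x)
    {J : Type*} [Fintype J] (a : J → R)
    (hJ : Fintype.card J + Fintype.card κ ≤ Module.finrank ℝ V) (v : V) :
    IsNowhereDense (Set.range fun m : J → ℕ => (∏ i, a i ^ m i) • v) := by
  let ev : R →ₗ[ℝ] V := (LinearMap.toSpanSingleton R V v).restrictScalars ℝ
  have hev : ∀ x, ev x = x • v := fun _ => rfl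
  by_cases hsurj : Function.Surjective ev
  · have hinj : Function.Injective ev := by
      refine (injective_iff_map_eq_zero ev).mpr fun x hx => ?_
      refine FaithfulSMul.eq_of_smul_eq_smul (α := V) fun w => ?_
      obtain ⟨y, rfl⟩ := hsurj w
      rw [hev, zero_smul, smul_comm, ← hev x, hx, smul_zero]
    let e : R ≃ₗ[ℝ] V := LinearEquiv.ofBijective ev ⟨hinj, hsurj⟩
    let f : R →ₐ[ℝ] (V →L[ℝ] V) :=
      (Module.End.toContinuousLinearMap V : _ ≃ₐ[ℝ] (V →L[ℝ] V)).toAlgHom.comp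
        (Algebra.lsmul ℝ ℝ V)
    have hf : Function.Injective f := by
      intro x y hxy
      refine FaithfulSMul.eq_of_smul_eq_smul (α := V) fun w => ?_
      exact congrArg (fun g : V →L[ℝ] V => g w) hxy
    -- The operator norm supplies the Banach algebra structure needed for exp.
    let _ : NormedCommRing R := NormedCommRing.induced R (V →L[ℝ] V) f hf
    let _ : NormedAlgebra ℝ R := NormedAlgebra.induced ℝ R (V →L[ℝ] V) f
    have : FiniteDimensional ℝ R := e.symm.finiteDimensional
    have : Nontrivial R := e.toEquiv.nontrivial
    have hR := isNowhereDense_range_prod π σ hπσ hnil a (by rwa [e.finrank_eq])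
    refine (isNowhereDense_homeomorph_image e.toContinuousLinearEquiv.toHomeomorph hR).mono ?_
    rintro _ ⟨m, rfl⟩
    exact ⟨_, ⟨m, rfl⟩, rfl⟩
  · refine (isNowhereDense_range_of_not_surjective hsurj).mono ?_
    rintro _ ⟨m, rfl⟩
    exact ⟨_, rfl⟩

-- Adjoining the central image of σ to the generators keeps the algebra commutative and lets the
-- splitting of π restrict to it.
open scoped IsMulCommutative in
theorem isNowhereDense_closure_smul {K : Type*} [Ring K] [Algebra ℝ K] [Module K V]
    [IsScalarTower ℝ K V] [FaithfulSMul K V]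
    (π : K →ₐ[ℝ] (ι → ℝ) × (κ → ℂ)) (σ : ((ι → ℝ) × (κ → ℂ)) →ₐ[ℝ] K)
    (hπσ : ∀ z, π (σ z) = z) (hnil : ∀ x, π x = 0 → IsNilpotent x)
    (hσ : ∀ z x, Commute (σ z) x)
    {J : Type*} [Fintype J] (a : J → K) (ha : ∀ i j, Commute (a i) (a j))
    (hJ : Fintype.card J + Fintype.card κ ≤ Module.finrank ℝ V) (v : V) :
    IsNowhereDense ((· • v) '' (Subsemigroup.closure (Set.range a) : Set K)) := by
  have hcomm : ∀ x ∈ Set.range a ∪ Set.range σ, ∀ y ∈ Set.range a ∪ Set.range σ,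
      x * y = y * x := by
    rintro _ (⟨i, rfl⟩ | ⟨z, rfl⟩) _ (⟨j, rfl⟩ | ⟨w, rfl⟩)
    exacts [ha i j, (hσ w _).symm, hσ z _, hσ z _]
  let R := Algebra.adjoin ℝ (Set.range a ∪ Set.range σ)
  have : IsMulCommutative R := Algebra.isMulCommutative_adjoin ℝ hcomm
  let a' : J → R := fun i => ⟨a i, Algebra.subset_adjoin (Or.inl ⟨i, rfl⟩)⟩
  let σ' : ((ι → ℝ) × (κ → ℂ)) →ₐ[ℝ] R :=
    σ.codRestrict R fun z => Algebra.subset_adjoin (Or.inr ⟨z, rfl⟩)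
  have : FaithfulSMul R V := ⟨fun {x y} h => Subtype.ext
    (FaithfulSMul.eq_of_smul_eq_smul (α := V) fun w => h w)⟩
  have hnil' : ∀ x, (π.comp R.val) x = 0 → IsNilpotent x := by
    intro x hx
    obtain ⟨m, hm⟩ := hnil x hx
    exact ⟨m, Subtype.ext (by simpa using hm)⟩
  refine (isNowhereDense_range_prod_smul (π.comp R.val) σ' (fun z => hπσ z) hnil' a' hJ v).mono ?_
  rintro _ ⟨x, hx, rfl⟩
  have hprod : ∃ m : J → ℕ, ((∏ i, a' i ^ m i : R) : K) = x := by
    classical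
    induction hx using Subsemigroup.closure_induction with
    | mem x hx =>
      obtain ⟨i, rfl⟩ := hx
      refine ⟨Pi.single i 1, ?_⟩
      rw [Finset.prod_eq_single i (fun j _ hj => by simp [hj]) (by simp)]
      simp [a']
    | mul x y _ _ hx hy =>
      obtain ⟨m, rfl⟩ := hx
      obtain ⟨k, rfl⟩ := hy
      refine ⟨m + k, ?_⟩
      simp only [Pi.add_apply, pow_add, Finset.prod_mul_distrib]
      rfl
  obtain ⟨m, rfl⟩ := hprod
  exact ⟨m, rfl⟩

end SplitModule

end AbelianSemigroup

namespace AbelianSemigroup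

/-! ### Triangular matrices with constant diagonal -/

section LowerTriangular

theorem lower_mul_apply {𝕜 : Type*} [Field 𝕜] {m : ℕ} {M N : Matrix (Fin m) (Fin m) 𝕜}
    (hM : ∀ i j, i < j → M i j = 0) (hN : ∀ i j, i < j → N i j = 0) {i j : Fin m} (hij : i ≤ j) :
    (M * N) i j = M i i * N i j := by
  rw [Matrix.mul_apply]
  refine Finset.sum_eq_single i (fun k _ hk => ?_) (by simp)
  rcases lt_or_gt_of_ne hk with h | h
  · rw [hN k j (h.trans_le hij), mul_zero]
  · rw [hM i k h, zero_mul]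

/-- The algebra `𝕋_m(𝕜)` of lower triangular `m × m` matrices with constant diagonal. -/
def lowerAlgebra (𝕜 : Type*) [Field 𝕜] (m : ℕ) : Subalgebra 𝕜 (Matrix (Fin m) (Fin m) 𝕜) where
  carrier := {M | ∃ μ : 𝕜, (∀ i, M i i = μ) ∧ ∀ i j, i < j → M i j = 0}
  mul_mem' := by
    rintro M N ⟨μ, hμ, hM⟩ ⟨ν, hν, hN⟩
    exact ⟨μ * ν, fun i => by rw [lower_mul_apply hM hN le_rfl, hμ, hν],
      fun i j hij => by rw [lower_mul_apply hM hN hij.le, hN i j hij, mul_zero]⟩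
  add_mem' := by
    rintro M N ⟨μ, hμ, hM⟩ ⟨ν, hν, hN⟩
    exact ⟨μ + ν, fun i => by simp [hμ, hν], fun i j hij => by simp [hM i j hij, hN i j hij]⟩
  algebraMap_mem' c := ⟨c, fun i => by simp [Matrix.algebraMap_matrix_apply],
    fun i j hij => by simp [Matrix.algebraMap_matrix_apply, hij.ne]⟩

variable {𝕜 : Type*} [Field 𝕜] {m : ℕ}

/-- The common diagonal entry, as a character of `𝕋_m(𝕜)`. -/
def diagChar (𝕜 : Type*) [Field 𝕜] (m : ℕ) [NeZero m] : lowerAlgebra 𝕜 m →ₐ[𝕜] 𝕜 :=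
  AlgHom.ofLinearMap
    { toFun := fun M => M.1 0 0
      map_add' := fun _ _ => rfl
      map_smul' := fun _ _ => rfl }
    (Matrix.one_apply_eq 0) fun ⟨_, _, _, hM⟩ ⟨_, _, _, hN⟩ => lower_mul_apply hM hN le_rfl

/-- Cayley–Hamilton: the characteristic polynomial is X ^ m. -/
theorem pow_eq_zero_of_diagChar_eq_zero [NeZero m] {M : lowerAlgebra 𝕜 m}
    (h : diagChar 𝕜 m M = 0) : M ^ m = 0 := by
  obtain ⟨M, μ, hμ, hM⟩ := M
  have h0 : M 0 0 = 0 := h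
  have hdiag : ∀ i, M i i = 0 := fun i => by rw [hμ, ← hμ 0, h0]
  have hup : Mᵀ.IsUpperTriangular := fun i j hij => hM j i hij
  have hchar : M.charpoly = Polynomial.X ^ m := by
    rw [← Matrix.charpoly_transpose, Matrix.charpoly_of_isUpperTriangular _ hup]
    simp [hdiag]
  have := Matrix.aeval_self_charpoly M
  rw [hchar, map_pow, Polynomial.aeval_X] at this
  exact Subtype.ext this

end LowerTriangular

/-! ### Complex matrices as real block matrices -/

section Realification

/-- The embedding of `ℂ` in the real `2 × 2` matrices with image `𝕊`. -/
noncomputable def complexToMatrix : ℂ →ₐ[ℝ] Matrix (Fin 2) (Fin 2) ℝ :=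
  AlgHom.ofLinearMap
    { toFun := fun z => !![z.re, z.im; -z.im, z.re]
      map_add' := fun z w => by
        ext i j; fin_cases i <;> fin_cases j <;> simp [add_comm]
      map_smul' := fun c z => by
        ext i j; fin_cases i <;> fin_cases j <;> simp }
    (by ext i j; fin_cases i <;> fin_cases j <;> simp)
    (fun z w => by
      ext i j
      fin_cases i <;> fin_cases j <;> simp [Matrix.mul_apply, Fin.sum_univ_two] <;> ring)

theorem complexToMatrix_apply (z : ℂ) : complexToMatrix z = !![z.re, z.im; -z.im, z.re] := rfl

theorem complexToMatrix_injective : Function.Injective complexToMatrix := by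
  intro z w h
  have h0 := congrFun (congrFun h 0) 0
  have h1 := congrFun (congrFun h 0) 1
  exact Complex.ext (by simpa [complexToMatrix_apply] using h0)
    (by simpa [complexToMatrix_apply] using h1)

/-- Complex `m × m` matrices as real matrices cut into `2 × 2` blocks. -/
noncomputable def realify (m : ℕ) :
    Matrix (Fin m) (Fin m) ℂ →ₐ[ℝ] Matrix (Fin m × Fin 2) (Fin m × Fin 2) ℝ :=
  (Matrix.compAlgEquiv (Fin m) (Fin 2) ℝ ℝ).toAlgHom.comp complexToMatrix.mapMatrix

theorem realify_apply {m : ℕ} (N : Matrix (Fin m) (Fin m) ℂ) (i j : Fin m) (a b : Fin 2) :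
    realify m N (i, a) (j, b) = complexToMatrix (N i j) a b := rfl

theorem realify_injective (m : ℕ) : Function.Injective (realify m) := by
  intro M N h
  ext i j : 2
  refine complexToMatrix_injective ?_
  ext a b
  exact congrFun (congrFun h (i, a)) (j, b)

theorem exists_realify_eq {m : ℕ} {B : Matrix (Fin m × Fin 2) (Fin m × Fin 2) ℝ}
    (hB : B ∈ complexBlock m) : ∃ N ∈ lowerAlgebra ℂ m, realify m N = B := by
  obtain ⟨_, ⟨α, β, rfl⟩, hdiag, hup, hlow⟩ := hB
  have hS : ∀ i j, ∃ z : ℂ, complexToMatrix z = subBlock B i j := by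
    intro i j
    rcases lt_trichotomy i j with h | rfl | h
    · exact ⟨0, by rw [hup i j h, map_zero]⟩
    · exact ⟨⟨α, β⟩, by rw [hdiag]; rfl⟩
    · obtain ⟨γ, δ, h⟩ := hlow i j h
      exact ⟨⟨γ, δ⟩, by rw [h]; rfl⟩
  choose N hN using hS
  refine ⟨Matrix.of N, ⟨⟨α, β⟩, fun i => complexToMatrix_injective ?_,
    fun i j hij => complexToMatrix_injective ?_⟩, ?_⟩
  · rw [Matrix.of_apply, hN, hdiag]; rfl
  · rw [Matrix.of_apply, hN, hup i j hij, map_zero]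
  · ext ⟨i, a⟩ ⟨j, b⟩
    rw [realify_apply, Matrix.of_apply, hN]
    rfl

end Realification

end AbelianSemigroup

namespace AbelianSemigroup

/-! ### The algebra of block tuples and its characters -/

section NormalFormAlgebra

variable {ι κ : Type*} (p : ι → ℕ) (q : κ → ℕ)

/-- The algebra of tuples of triangular blocks, the blocks in `𝔹_m(ℝ)` being read as complex
matrices. -/
abbrev BlockAlgebra : Type _ :=
  (∀ k, lowerAlgebra ℝ (p k)) × (∀ l, lowerAlgebra ℂ (q l))

/-- The characters of the algebra of block tuples. -/
noncomputable def blockChar [∀ k, NeZero (p k)] [∀ l, NeZero (q l)] :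
    BlockAlgebra p q →ₐ[ℝ] (ι → ℝ) × (κ → ℂ) :=
  AlgHom.prodMap
    (AlgHom.pi fun k => (diagChar ℝ (p k)).comp (Pi.evalAlgHom ℝ _ k))
    (AlgHom.pi fun l => ((diagChar ℂ (q l)).restrictScalars ℝ).comp (Pi.evalAlgHom ℝ _ l))

/-- The tuples of scalar blocks. -/
noncomputable def blockScalar : ((ι → ℝ) × (κ → ℂ)) →ₐ[ℝ] BlockAlgebra p q :=
  AlgHom.prodMap
    (AlgHom.pi fun k => (Algebra.ofId ℝ (lowerAlgebra ℝ (p k))).comp (Pi.evalAlgHom ℝ _ k))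
    (AlgHom.pi fun l =>
      ((Algebra.ofId ℂ (lowerAlgebra ℂ (q l))).restrictScalars ℝ).comp (Pi.evalAlgHom ℝ _ l))

theorem blockChar_blockScalar [∀ k, NeZero (p k)] [∀ l, NeZero (q l)]
    (z : (ι → ℝ) × (κ → ℂ)) : blockChar p q (blockScalar p q z) = z :=
  Prod.ext (funext fun k => (diagChar ℝ (p k)).commutes (z.1 k))
    (funext fun l => (diagChar ℂ (q l)).commutes (z.2 l))

theorem commute_blockScalar (z : (ι → ℝ) × (κ → ℂ)) (x : BlockAlgebra p q) :
    Commute (blockScalar p q z) x :=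
  Prod.ext (funext fun k => Algebra.commutes (z.1 k) (x.1 k))
    (funext fun l => Algebra.commutes (z.2 l) (x.2 l))

theorem isNilpotent_of_blockChar_eq_zero [Fintype ι] [Fintype κ] [∀ k, NeZero (p k)]
    [∀ l, NeZero (q l)] {x : BlockAlgebra p q} (hx : blockChar p q x = 0) : IsNilpotent x := by
  have h1 : ∀ k, x.1 k ^ p k = 0 := fun k =>
    pow_eq_zero_of_diagChar_eq_zero (congrFun (congrArg Prod.fst hx) k)
  have h2 : ∀ l, x.2 l ^ q l = 0 := fun l =>
    pow_eq_zero_of_diagChar_eq_zero (congrFun (congrArg Prod.snd hx) l)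
  refine ⟨∑ k, p k + ∑ l, q l, Prod.ext (funext fun k => ?_) (funext fun l => ?_)⟩
  · exact pow_eq_zero_of_le ((Finset.single_le_sum (fun _ _ => Nat.zero_le _)
      (Finset.mem_univ k)).trans (Nat.le_add_right _ _)) (h1 k)
  · exact pow_eq_zero_of_le ((Finset.single_le_sum (fun _ _ => Nat.zero_le _)
      (Finset.mem_univ l)).trans (Nat.le_add_left _ _)) (h2 l)

variable [Fintype ι] [DecidableEq ι] [Fintype κ] [DecidableEq κ]

/-- The block diagonal real matrix with given blocks. -/
noncomputable def blockMatrix : BlockAlgebra p q →ₐ[ℝ]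
    Matrix ((Σ k, Fin (p k)) ⊕ (Σ l, Fin (q l) × Fin 2))
      ((Σ k, Fin (p k)) ⊕ (Σ l, Fin (q l) × Fin 2)) ℝ :=
  AlgHom.ofLinearMap
    { toFun := fun x => Matrix.fromBlocks (Matrix.blockDiagonal' fun k => (x.1 k).1) 0 0
        (Matrix.blockDiagonal' fun l => realify (q l) (x.2 l).1)
      map_add' := fun x y => by
        rw [Matrix.fromBlocks_add, ← Matrix.blockDiagonal'_add, ← Matrix.blockDiagonal'_add]
        simp only [add_zero]
        congr 2
        funext l
        exact map_add (realify (q l)) _ _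
      map_smul' := fun c x => by
        rw [RingHom.id_apply, Matrix.fromBlocks_smul, ← Matrix.blockDiagonal'_smul,
          ← Matrix.blockDiagonal'_smul]
        simp only [smul_zero]
        congr 2
        funext l
        exact map_smul (realify (q l)) c _ }
    (by
      change Matrix.fromBlocks (Matrix.blockDiagonal' fun k => 1) 0 0
        (Matrix.blockDiagonal' fun l => realify (q l) 1) = 1
      rw [← Matrix.fromBlocks_one, ← Matrix.blockDiagonal'_one, ← Matrix.blockDiagonal'_one]
      congr 2
      funext l
      exact map_one (realify (q l)))
    (fun x y => by
      change Matrix.fromBlocks (Matrix.blockDiagonal' fun k => (x.1 k).1 * (y.1 k).1) 0 0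
        (Matrix.blockDiagonal' fun l => realify (q l) ((x.2 l).1 * (y.2 l).1)) =
        Matrix.fromBlocks (Matrix.blockDiagonal' fun k => (x.1 k).1) 0 0
          (Matrix.blockDiagonal' fun l => realify (q l) (x.2 l).1) *
        Matrix.fromBlocks (Matrix.blockDiagonal' fun k => (y.1 k).1) 0 0
          (Matrix.blockDiagonal' fun l => realify (q l) (y.2 l).1)
      rw [Matrix.fromBlocks_multiply, ← Matrix.blockDiagonal'_mul, ← Matrix.blockDiagonal'_mul]
      simp only [map_mul, Matrix.mul_zero, Matrix.zero_mul, add_zero, zero_add])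

theorem blockMatrix_apply (x : BlockAlgebra p q) :
    blockMatrix p q x = Matrix.fromBlocks (Matrix.blockDiagonal' fun k => (x.1 k).1) 0 0
      (Matrix.blockDiagonal' fun l => realify (q l) (x.2 l).1) := rfl

theorem blockMatrix_injective : Function.Injective (blockMatrix p q) := by
  intro x y h
  rw [blockMatrix_apply, blockMatrix_apply, Matrix.fromBlocks_inj, Matrix.blockDiagonal'_inj,
    Matrix.blockDiagonal'_inj] at h
  exact Prod.ext (funext fun k => Subtype.ext (congrFun h.1 k))
    (funext fun l => Subtype.ext (realify_injective _ (congrFun h.2.2.2 l)))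

end NormalFormAlgebra

/-! ### Embedding the block algebra as conjugated normal forms -/

section NormalForms

variable {n r s : ℕ} (η : BlockSizes n r s) (P : GL (Fin n) ℝ)

/-- Makes the truncated n - s a true difference, so that n - s logarithms and s periods total n. -/
theorem BlockSizes.le (η : BlockSizes n r s) : s ≤ n := by
  have h : s ≤ ∑ l, η.complexSize l := by
    simpa using Finset.card_nsmul_le_sum Finset.univ η.complexSize 1 fun l _ =>
      η.complexSize_pos l
  have := η.sum_eq
  omega

/-- The conjugate by `P` of the normal form with given blocks. -/
noncomputable def normalFormHom :
    BlockAlgebra η.realSize η.complexSize →ₐ[ℝ] Matrix (Fin n) (Fin n) ℝ :=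
  ((MulSemiringAction.toAlgEquiv ℝ (Matrix (Fin n) (Fin n) ℝ) (ConjAct.toConjAct P)).toAlgHom.comp
    (Matrix.reindexAlgEquiv ℝ ℝ η.position).toAlgHom).comp
    (blockMatrix η.realSize η.complexSize)

theorem normalFormHom_apply (x : BlockAlgebra η.realSize η.complexSize) :
    normalFormHom η P x = (P : Matrix (Fin n) (Fin n) ℝ) *
      Matrix.reindex η.position η.position (blockMatrix η.realSize η.complexSize x) *
      ((P⁻¹ : GL (Fin n) ℝ) : Matrix (Fin n) (Fin n) ℝ) := rfl

theorem normalFormHom_injective : Function.Injective (normalFormHom η P) :=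
  ((MulSemiringAction.toAlgEquiv ℝ (Matrix (Fin n) (Fin n) ℝ)
    (ConjAct.toConjAct P)).injective.comp
    (Matrix.reindexAlgEquiv ℝ ℝ η.position).injective).comp (blockMatrix_injective _ _)

theorem exists_normalFormHom_eq {A : Matrix (Fin n) (Fin n) ℝ}
    (hA : ((P⁻¹ : GL (Fin n) ℝ) : Matrix (Fin n) (Fin n) ℝ) * A *
      (P : Matrix (Fin n) (Fin n) ℝ) ∈ normalForms η) : ∃ x, normalFormHom η P x = A := by
  obtain ⟨T, B, hT, hB, h⟩ := hA
  choose N hN hNB using fun l => exists_realify_eq (hB l)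
  refine ⟨(fun k => ⟨T k, hT k⟩, fun l => ⟨N l, hN l⟩), ?_⟩
  rw [normalFormHom_apply, blockMatrix_apply]
  simp only [hNB]
  rw [← h]
  simp [mul_assoc]

end NormalForms

end AbelianSemigroup

theorem corollary1p5 (n r s : ℕ) (hn : 1 ≤ n) (η : AbelianSemigroup.BlockSizes n r s)
    (G : Subsemigroup (Matrix (Fin n) (Fin n) ℝ))
    (hcomm : ∀ A ∈ G, ∀ B ∈ G, A * B = B * A)
    (hnormal : AbelianSemigroup.HasNormalFormIn G η)
    (hgen : ∃ A : Fin (n - s) → Matrix (Fin n) (Fin n) ℝ,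
      Subsemigroup.closure (Set.range A) = G)
    (v : Fin n → ℝ) :
    IsNowhereDense (AbelianSemigroup.orbit G v) := by
  obtain ⟨P, hP⟩ := hnormal
  obtain ⟨A, rfl⟩ := hgen
  have hA : ∀ i, A i ∈ Subsemigroup.closure (Set.range A) := fun i =>
    Subsemigroup.subset_closure ⟨i, rfl⟩
  have : ∀ k, NeZero (η.realSize k) := fun k => ⟨(η.realSize_pos k).ne'⟩
  have : ∀ l, NeZero (η.complexSize l) := fun l => ⟨(η.complexSize_pos l).ne'⟩
  have : Nonempty (Fin n) := ⟨⟨0, hn⟩⟩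
  choose x hx using fun i => AbelianSemigroup.exists_normalFormHom_eq η P (hP _ (hA i))
  let K := AbelianSemigroup.BlockAlgebra η.realSize η.complexSize
  let ρ : K →ₐ[ℝ] Module.End ℝ (Fin n → ℝ) :=
    (Matrix.toLinAlgEquiv' : _ ≃ₐ[ℝ] Module.End ℝ (Fin n → ℝ)).toAlgHom.comp
      (AbelianSemigroup.normalFormHom η P)
  have hρ : Function.Injective ρ :=
    (Matrix.toLinAlgEquiv' : _ ≃ₐ[ℝ] Module.End ℝ (Fin n → ℝ)).injective.comp
      (AbelianSemigroup.normalFormHom_injective η P)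
  let _ : Module K (Fin n → ℝ) := Module.compHom (Fin n → ℝ) ρ.toRingHom
  have hsmul : ∀ (y : K) w, y • w = AbelianSemigroup.normalFormHom η P y *ᵥ w := fun _ _ => rfl
  have : IsScalarTower ℝ K (Fin n → ℝ) := ⟨fun c y w => by
    rw [hsmul, hsmul, map_smul, Matrix.smul_mulVec]⟩
  have : FaithfulSMul K (Fin n → ℝ) := ⟨fun h => hρ (LinearMap.ext h)⟩
  have hxcomm : ∀ i j, Commute (x i) (x j) := fun i j =>
    AbelianSemigroup.normalFormHom_injective η P (by
      rw [map_mul, map_mul, hx, hx, hcomm _ (hA i) _ (hA j)])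
  refine (AbelianSemigroup.isNowhereDense_closure_smul
    (AbelianSemigroup.blockChar η.realSize η.complexSize)
    (AbelianSemigroup.blockScalar η.realSize η.complexSize)
    (AbelianSemigroup.blockChar_blockScalar _ _)
    (fun _ => AbelianSemigroup.isNilpotent_of_blockChar_eq_zero _ _)
    (AbelianSemigroup.commute_blockScalar _ _) x hxcomm
    (by simp [Nat.sub_add_cancel η.le]) v).mono ?_
  rintro _ ⟨M, hM, rfl⟩
  -- The lifts of the generators generate a semigroup of block tuples mapping onto the given one.
  have hmap : (Subsemigroup.closure (Set.range x)).map
      (AbelianSemigroup.normalFormHom η P : K →ₙ* Matrix (Fin n) (Fin n) ℝ) =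
      Subsemigroup.closure (Set.range A) := by
    rw [MulHom.map_mclosure, ← Set.range_comp]
    exact congrArg (fun f => Subsemigroup.closure (Set.range f)) (funext hx)
  rw [← hmap] at hM
  obtain ⟨y, hy, rfl⟩ := hM
  exact ⟨y, hy, rfl⟩
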